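/- Let $K \subset L$ be an extension of (commutative) fields such that every element of $L$ that is algebraic over $K$ is separable over $K$. Let $B$ be a finite-dimensional $K$-subspace of $L$ with $1 \in B$. For an integer $m \ge 0$ let $B^m = \{b_1 b_2 \cdots b_m \mid b_1,\dots,b_m \in B\}$ be the $m$-fold product set (so $B^0=\{1\}$), and let $\langle B^m\rangle$ denote the $K$-subspace of $L$ spanned by $B^m$. Then, for every integer $n \ge 1$, either $$\langle B^{n+1}\rangle = \langle B^{n}\rangle$$ or $$\dim_K \langle B^{n+1}\rangle \ \ge\ \dim_K \langle B^{n-1}\rangle + \dim_K B.$$ -/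

import Mathlib

open scoped Pointwise

/-!
The proof is the linear version of Hamidoune's isoperimetric method.

After replacing `L` by `K(B)`, assume that `B` lies in no proper intermediate field. Among the
nonzero finite-dimensional subspaces `X` with `X * B ≠ L`, choose one that minimises the boundary
`dim (X * B) - dim X`, and among these one of least dimension: an *atom*. Two atoms that meet
nontrivially are equal (`IsBoundaryAtom.eq_of_inf_ne_bot`). This follows from submodularity of the
boundary, provided that `(X + Y) * B ≠ L`, which is automatic if `L` is infinite-dimensional. If
`L` is finite-dimensional it follows from duality with respect to a form `(x, y) ↦ f (x * y)`: the
orthogonal space of `X * B` has boundary at most that of `X`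
(`exists_orthogonal_of_mul`), so if `X` is an atom, its dimension is at least `dim X`.

As multiplying by a nonzero scalar of `L` maps atoms to atoms, an atom `H` that contains `1`
satisfies `x • H = H` for all nonzero `x ∈ H`, so it is a subfield. Now `B` is not contained in `H`,
so `H * B` has dimension at least two over `H`, and the minimal boundary `dim (H * B) - dim H` is at
least `dim (H * B) / 2 ≥ dim B / 2`. Hence each multiplication by `B` that does not lead to all of
`L` raises the dimension by at least `dim B / 2` (`finrank_add_half_le_finrank_mul`). If
`B ^ (n + 1) ≠ L`, apply this to the two steps from `B ^ (n - 1)` to `B ^ (n + 1)`. If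
`B ^ (n + 1) = L`, then either `dim B ^ (n - 1) + dim B ≤ dim L`, or `B ^ (n - 1) * B = L` by
duality, and then `B ^ n = B ^ (n + 1)`.
-/

open Module

/-! ### Products of subspaces of a field extension -/

section

variable {K L : Type*} [Field K] [Field L] [Algebra K L]

theorem finiteDimensional_submodule_mul (X Y : Submodule K L) [FiniteDimensional K X]
    [FiniteDimensional K Y] : FiniteDimensional K (X * Y : Submodule K L) :=
  Module.Finite.iff_fg.2 ((Module.Finite.iff_fg.1 ‹_›).mul (Module.Finite.iff_fg.1 ‹_›))

theorem le_mul_of_one_mem_right {B : Submodule K L} (hB : (1 : L) ∈ B) (X : Submodule K L) :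
    X ≤ X * B := fun x hx => by simpa using Submodule.mul_mem_mul hx hB

theorem span_singleton_mul_eq_map (x : L) (X : Submodule K L) :
    Submodule.span K {x} * X = X.map (LinearMap.mulLeft K x) := by
  ext y
  simp [Submodule.mem_span_singleton_mul]

theorem finrank_span_singleton_mul {x : L} (hx : x ≠ 0) (X : Submodule K L) :
    finrank K (Submodule.span K {x} * X : Submodule K L) = finrank K X := by
  rw [span_singleton_mul_eq_map]
  exact (LinearEquiv.finrank_eq
    (X.equivMapOfInjective (LinearMap.mulLeft K x) (mul_right_injective₀ hx))).symm

theorem finrank_le_finrank_mul {X B : Submodule K L} [FiniteDimensional K X]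
    [FiniteDimensional K B] (hX : X ≠ ⊥) :
    finrank K B ≤ finrank K (X * B : Submodule K L) := by
  obtain ⟨x, hx, hx0⟩ := Submodule.exists_mem_ne_zero_of_ne_bot hX
  have := finiteDimensional_submodule_mul X B
  rw [← finrank_span_singleton_mul hx0 B]
  exact Submodule.finrank_mono (mul_le_mul_left (by simpa using hx) B)

/-- For a linear form `f ≠ 0` on `L`, the subspace produced is the orthogonal of `X * B` with
respect to `(x, y) ↦ f (x * y)`; its product with `B` is orthogonal to `X`. -/
theorem exists_orthogonal_of_mul [FiniteDimensional K L] (X B : Submodule K L) :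
    ∃ Y : Submodule K L, finrank K Y + finrank K (X * B : Submodule K L) = finrank K L ∧
      finrank K (Y * B : Submodule K L) + finrank K X ≤ finrank K L := by
  obtain ⟨f, hf⟩ : ∃ f : Module.Dual K L, f 1 ≠ 0 := by
    by_contra! h
    exact one_ne_zero ((Module.forall_dual_apply_eq_zero_iff K (1 : L)).1 h)
  let Φ : LinearMap.BilinForm K L := (LinearMap.mul K L).compr₂ f
  have hΦ (x y : L) : Φ x y = f (x * y) := rfl
  have hnd : Φ.Nondegenerate := by
    constructor
    · intro x hx
      by_contra h
      exact hf (by simpa [hΦ, h] using hx x⁻¹)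
    · intro x hx
      by_contra h
      exact hf (by simpa [hΦ, h] using hx x⁻¹)
  have horth (W : Submodule K L) : finrank K (Φ.orthogonal W) + finrank K W = finrank K L := by
    rw [LinearMap.BilinForm.finrank_orthogonal hnd]
    exact Nat.sub_add_cancel W.finrank_le
  refine ⟨Φ.orthogonal (X * B), horth _, ?_⟩
  rw [← horth X]
  gcongr
  refine Submodule.finrank_mono (Submodule.mul_le.2 fun y hy b hb => ?_)
  intro x hx
  have := hy (x * b) (Submodule.mul_mem_mul hx hb)
  rw [hΦ] at this ⊢
  rw [← this]
  congr 1
  ring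

/-- The linear analogue of the fact that `|X| + |B| > |G|` forces `X * B = G` in a finite
group. -/
theorem mul_eq_top_of_finrank_lt [FiniteDimensional K L] {X B : Submodule K L}
    (h : finrank K L < finrank K X + finrank K B) : X * B = ⊤ := by
  by_contra hXB
  obtain ⟨Y, hY, hYB⟩ := exists_orthogonal_of_mul X B
  have hY0 : Y ≠ ⊥ := by
    rintro rfl
    have := Submodule.finrank_lt hXB
    simp at hY
    lia
  have := finrank_le_finrank_mul (B := B) hY0
  lia

/-! ### Atoms of the boundary functional -/

/-- The subspaces over which the boundary `dim (X * B) - dim X` is minimised. -/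
structure IsAdmissible (B X : Submodule K L) : Prop where
  ne_bot : X ≠ ⊥
  finite : FiniteDimensional K X
  mul_ne_top : X * B ≠ ⊤

/-- An atom for `B`: an admissible subspace of minimal boundary, and of least dimension among those
of minimal boundary. The inequalities between boundaries `dim (X * B) - dim X` are written without
subtraction. -/
structure IsBoundaryAtom (B A : Submodule K L) : Prop extends IsAdmissible B A where
  boundary_le : ∀ X, IsAdmissible B X →
    finrank K (A * B : Submodule K L) + finrank K X ≤
      finrank K (X * B : Submodule K L) + finrank K A
  finrank_le : ∀ X, IsAdmissible B X →
    finrank K (X * B : Submodule K L) + finrank K A ≤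
      finrank K (A * B : Submodule K L) + finrank K X → finrank K A ≤ finrank K X

variable {B : Submodule K L}

theorem exists_isBoundaryAtom [FiniteDimensional K B] (hB : (1 : L) ∈ B) {X : Submodule K L}
    (hX : IsAdmissible B X) : ∃ A, IsBoundaryAtom B A := by
  have hle (X : Submodule K L) (hX : IsAdmissible B X) :
      finrank K X ≤ finrank K (X * B : Submodule K L) := by
    have := hX.finite
    have := finiteDimensional_submodule_mul X B
    exact Submodule.finrank_mono (le_mul_of_one_mem_right hB X)
  let μ : Submodule K L → ℕ ×ₗ ℕ := fun X =>
    toLex (finrank K (X * B : Submodule K L) - finrank K X, finrank K X)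
  obtain ⟨A, hA, hmin⟩ :=
    (InvImage.wf μ wellFounded_lt).has_min {X | IsAdmissible B X} ⟨X, hX⟩
  have hmin' (X : Submodule K L) (hX : IsAdmissible B X) :
      finrank K (A * B : Submodule K L) - finrank K A <
          finrank K (X * B : Submodule K L) - finrank K X ∨
        finrank K (A * B : Submodule K L) - finrank K A =
          finrank K (X * B : Submodule K L) - finrank K X ∧ finrank K A ≤ finrank K X := by
    have := not_lt.1 (hmin X hX)
    simpa [μ, Prod.Lex.le_iff] using this
  refine ⟨A, hA, fun X hX => ?_, fun X hX h => ?_⟩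
  · have := hmin' X hX
    have := hle X hX
    have := hle A hA
    lia
  · have := hmin' X hX
    have := hle X hX
    have := hle A hA
    lia

theorem IsBoundaryAtom.span_singleton_mul {A : Submodule K L} (hA : IsBoundaryAtom B A) {x : L}
    (hx : x ≠ 0) : IsBoundaryAtom B (Submodule.span K {x} * A) := by
  have h1 : finrank K (Submodule.span K {x} * A : Submodule K L) = finrank K A :=
    finrank_span_singleton_mul hx A
  have h2 : finrank K (Submodule.span K {x} * A * B : Submodule K L) =
      finrank K (A * B : Submodule K L) := by
    rw [mul_assoc, finrank_span_singleton_mul hx]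
  refine ⟨⟨?_, ?_, ?_⟩, ?_, ?_⟩
  · exact mul_ne_zero (by simpa using hx) hA.ne_bot
  · have := hA.finite
    exact finiteDimensional_submodule_mul _ _
  · intro h
    apply hA.mul_ne_top
    have : Submodule.span K {x⁻¹} * (Submodule.span K {x} * A * B) = A * B := by
      rw [mul_assoc, ← mul_assoc, Submodule.span_mul_span, Set.singleton_mul_singleton,
        inv_mul_cancel₀ hx, ← Submodule.one_eq_span, one_mul]
    rw [← this, h, eq_top_iff]
    intro y _
    exact Submodule.mem_span_singleton_mul.2 ⟨x * y, trivial, by field_simp⟩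
  · rw [h1, h2]
    exact hA.boundary_le
  · rw [h1, h2]
    exact hA.finrank_le

/-- The boundary is submodular, so if the atoms `X ≠ Y` met, then `X ⊔ Y` would have a boundary
smaller than the minimum. -/
theorem IsBoundaryAtom.eq_of_inf_ne_bot [FiniteDimensional K B] {X Y : Submodule K L}
    (hX : IsBoundaryAtom B X) (hY : IsBoundaryAtom B Y) (hXY : X ⊓ Y ≠ ⊥) : X = Y := by
  have := hX.finite
  have := hY.finite
  have := finiteDimensional_submodule_mul X B
  have := finiteDimensional_submodule_mul Y B
  have hYX := hX.boundary_le Y hY.toIsAdmissible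
  have hXY' := hY.boundary_le X hX.toIsAdmissible
  have hdXY := hX.finrank_le Y hY.toIsAdmissible (by lia)
  have hdYX := hY.finrank_le X hX.toIsAdmissible (by lia)
  have hI : IsAdmissible B (X ⊓ Y) :=
    ⟨hXY, Submodule.finiteDimensional_inf_left X Y, fun h => hX.mul_ne_top <|
      top_le_iff.1 (h ▸ mul_le_mul_left inf_le_left B)⟩
  have hI1 := hX.boundary_le _ hI
  have hI2 := hX.finrank_le _ hI
  by_contra hne
  have hlt : finrank K (X ⊓ Y : Submodule K L) < finrank K X := by
    refine Submodule.finrank_lt_finrank_of_lt (lt_of_le_of_ne inf_le_left fun h => hne ?_)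
    exact Submodule.eq_of_le_of_finrank_eq (inf_eq_left.1 h) (by lia)
  have hdim := Submodule.finrank_sup_add_finrank_inf_eq X Y
  have hdimB := Submodule.finrank_sup_add_finrank_inf_eq (X * B) (Y * B)
  have hinf : finrank K ((X ⊓ Y) * B : Submodule K L) ≤
      finrank K (X * B ⊓ Y * B : Submodule K L) :=
    Submodule.finrank_mono <|
      le_inf (mul_le_mul_left inf_le_left B) (mul_le_mul_left inf_le_right B)
  have hsup : (X ⊔ Y) * B = X * B ⊔ Y * B := Submodule.sup_mul X Y B
  have hS : IsAdmissible B (X ⊔ Y) := by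
    refine ⟨fun h => hX.ne_bot (le_bot_iff.1 (h ▸ le_sup_left)), inferInstance, fun h => ?_⟩
    rw [hsup] at h
    rw [h, finrank_top] at hdimB
    have : FiniteDimensional K L := by
      have : FiniteDimensional K (⊤ : Submodule K L) := h ▸ inferInstance
      exact Module.Finite.equiv Submodule.topEquiv
    obtain ⟨Z, hZ, hZB⟩ := exists_orthogonal_of_mul X B
    have hXB := Submodule.finrank_lt hX.mul_ne_top
    have hXpos : 0 < finrank K X := Nat.pos_of_ne_zero fun h =>
      hX.ne_bot (Submodule.finrank_eq_zero.1 h)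
    -- The dual `Z` of `X` is admissible and has minimal boundary, so `dim X ≤ dim Z`, and hence
    -- `dim L = dim Z + dim (X * B)` is too large for `X * B ⊔ Y * B` to be everything.
    have hZadm : IsAdmissible B Z := by
      refine ⟨?_, inferInstance, ?_⟩
      · rintro rfl
        simp at hZ
        lia
      · intro h
        rw [h, finrank_top] at hZB
        lia
    have := hX.finrank_le Z hZadm (by lia)
    lia
  have := hX.boundary_le _ hS
  rw [hsup] at this
  lia

theorem IsBoundaryAtom.exists_intermediateField [FiniteDimensional K B] {A : Submodule K L}
    (hA : IsBoundaryAtom B A) :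
    ∃ H : IntermediateField K L, IsBoundaryAtom B (Subalgebra.toSubmodule H.toSubalgebra) := by
  obtain ⟨a, ha, ha0⟩ := Submodule.exists_mem_ne_zero_of_ne_bot hA.ne_bot
  obtain ⟨H, hH, h1⟩ : ∃ H, IsBoundaryAtom B H ∧ (1 : L) ∈ H :=
    ⟨_, hA.span_singleton_mul (inv_ne_zero ha0),
      Submodule.mem_span_singleton_mul.2 ⟨a, ha, inv_mul_cancel₀ ha0⟩⟩
  have key {x : L} (hx : x ∈ H) (hx0 : x ≠ 0) : H = Submodule.span K {x} * H := by
    refine hH.eq_of_inf_ne_bot (hH.span_singleton_mul hx0) fun h => hx0 ?_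
    rw [← Submodule.mem_bot K, ← h]
    exact ⟨hx, Submodule.mem_span_singleton_mul.2 ⟨1, h1, mul_one x⟩⟩
  have hmul {x y : L} (hx : x ∈ H) (hy : y ∈ H) : x * y ∈ H := by
    by_cases hx0 : x = 0
    · simp [hx0]
    · rw [key hx hx0]
      exact Submodule.mem_span_singleton_mul.2 ⟨y, hy, rfl⟩
  have hinv {x : L} (hx : x ∈ H) : x⁻¹ ∈ H := by
    by_cases hx0 : x = 0
    · simp [hx0]
    · have h := h1
      rw [key hx hx0] at h
      obtain ⟨y, hy, hxy⟩ := Submodule.mem_span_singleton_mul.1 h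
      rwa [inv_eq_of_mul_eq_one_right hxy]
  exact ⟨{ H.toSubalgebra h1 fun x y hx hy => hmul hx hy with inv_mem' := fun x hx => hinv hx },
    by simpa using hH⟩

/-! ### Growth under multiplication by a generating subspace -/

theorem two_mul_finrank_le_finrank_mul [FiniteDimensional K B] (hB : (1 : L) ∈ B)
    (H : IntermediateField K L) [FiniteDimensional K H] {b : L} (hb : b ∈ B) (hbH : b ∉ H) :
    2 * finrank K H ≤
      finrank K (Subalgebra.toSubmodule H.toSubalgebra * B : Submodule K L) := by
  set S : Submodule K L := Subalgebra.toSubmodule H.toSubalgebra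
  have hmem {x : L} : x ∈ S ↔ x ∈ H := Iff.rfl
  have : FiniteDimensional K S := ‹FiniteDimensional K H›
  have := finiteDimensional_submodule_mul S B
  have := finiteDimensional_submodule_mul (Submodule.span K {b}) S
  have hb0 : b ≠ 0 := fun h => hbH (h ▸ H.zero_mem)
  have hdisj : S ⊓ Submodule.span K {b} * S = ⊥ := by
    rw [eq_bot_iff]
    rintro x ⟨hx, hx'⟩
    obtain ⟨z, hz, rfl⟩ := Submodule.mem_span_singleton_mul.1 hx'
    by_contra h
    have hz0 : z ≠ 0 := by rintro rfl; simp at h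
    refine hbH ?_
    have := H.mul_mem (hmem.1 hx) (H.inv_mem (hmem.1 hz))
    rwa [mul_inv_cancel_right₀ hz0] at this
  have hle : S ⊔ Submodule.span K {b} * S ≤ S * B := by
    refine sup_le (le_mul_of_one_mem_right hB S) ?_
    rw [mul_comm]
    exact mul_le_mul_right (by simpa using hb) S
  have hdim := Submodule.finrank_sup_add_finrank_inf_eq S (Submodule.span K {b} * S)
  rw [hdisj, finrank_bot, finrank_span_singleton_mul hb0] at hdim
  have := Submodule.finrank_mono hle
  have hSH : finrank K S = finrank K H := rfl
  lia

/-- The linear analogue of Olson's inequality `|X * B| ≥ |X| + |B| / 2`. -/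
theorem finrank_add_half_le_finrank_mul [FiniteDimensional K B] (hB : (1 : L) ∈ B)
    (hgen : ∀ H : IntermediateField K L, (B : Set L) ⊆ H → H = ⊤) {X : Submodule K L}
    (hX : IsAdmissible B X) :
    2 * finrank K X + finrank K B ≤ 2 * finrank K (X * B : Submodule K L) := by
  obtain ⟨A, hA⟩ := exists_isBoundaryAtom hB hX
  obtain ⟨H, hH⟩ := hA.exists_intermediateField
  have : FiniteDimensional K H := hH.finite
  obtain ⟨b, hb, hbH⟩ : ∃ b ∈ B, b ∉ H := by
    by_contra! h
    obtain rfl := hgen H h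
    exact hH.mul_ne_top (top_le_iff.1 (le_mul_of_one_mem_right hB _))
  have h1 := two_mul_finrank_le_finrank_mul hB H hb hbH
  have := hH.finite
  have h2 := finrank_le_finrank_mul (B := B) hH.ne_bot
  have h3 := hH.boundary_le X hX
  have h4 : finrank K (Subalgebra.toSubmodule H.toSubalgebra) = finrank K H := rfl
  lia

theorem pow_dichotomy_of_generating [FiniteDimensional K B] (hB : (1 : L) ∈ B)
    (hgen : ∀ H : IntermediateField K L, (B : Set L) ⊆ H → H = ⊤) (m : ℕ) :
    B ^ (m + 2) = B ^ (m + 1) ∨ finrank K (B ^ m : Submodule K L) + finrank K B ≤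
      finrank K (B ^ (m + 2) : Submodule K L) := by
  have hfin (k : ℕ) : FiniteDimensional K (B ^ k : Submodule K L) :=
    Module.Finite.iff_fg.2 ((Module.Finite.iff_fg.1 ‹FiniteDimensional K B›).pow k)
  have hB0 : B ≠ 0 := by
    rintro rfl
    exact one_ne_zero ((Submodule.mem_bot K).1 hB)
  have hle (k : ℕ) : B ^ k ≤ B ^ (k + 1) := pow_succ B k ▸ le_mul_of_one_mem_right hB _
  by_cases htop : B ^ (m + 2) = ⊤
  · have : FiniteDimensional K L := by
      have : FiniteDimensional K (⊤ : Submodule K L) := htop ▸ hfin (m + 2)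
      exact Module.Finite.equiv Submodule.topEquiv
    by_cases h : finrank K L < finrank K (B ^ m : Submodule K L) + finrank K B
    · left
      rw [htop, pow_succ, mul_eq_top_of_finrank_lt h]
    · right
      rw [htop, finrank_top]
      exact not_lt.1 h
  · right
    have h1 : IsAdmissible B (B ^ (m + 1)) := ⟨pow_ne_zero _ hB0, hfin _, pow_succ B (m + 1) ▸ htop⟩
    have h0 : IsAdmissible B (B ^ m) :=
      ⟨pow_ne_zero _ hB0, hfin _, fun h => htop <| top_le_iff.1 <| by
        rw [← h, ← pow_succ]
        exact hle (m + 1)⟩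
    have e1 := finrank_add_half_le_finrank_mul hB hgen h1
    have e0 := finrank_add_half_le_finrank_mul hB hgen h0
    rw [← pow_succ] at e0 e1
    lia

end

theorem mainTheorem6 {K L : Type*} [Field K] [Field L] [Algebra K L]
    (hsep : ∀ x : L, IsAlgebraic K x → IsSeparable K x)
    (B : Submodule K L) [FiniteDimensional K B] (hB : (1 : L) ∈ B)
    (n : ℕ) (hn : 1 ≤ n) :
    Submodule.span K ((B : Set L) ^ (n + 1)) = Submodule.span K ((B : Set L) ^ n) ∨
      Module.finrank K (Submodule.span K ((B : Set L) ^ (n - 1))) + Module.finrank K B ≤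
        Module.finrank K (Submodule.span K ((B : Set L) ^ (n + 1))) := by
  obtain ⟨m, rfl⟩ : ∃ m, n = m + 1 := ⟨n - 1, by lia⟩
  rw [Nat.add_sub_cancel]
  -- Replace `L` by `M = K(B)`, with `C` the subspace `B` regarded inside `M`.
  let M : IntermediateField K L := IntermediateField.adjoin K (B : Set L)
  have hBM : (B : Set L) ⊆ M := IntermediateField.subset_adjoin K _
  let C : Submodule K M := B.comap M.val.toLinearMap
  have hinj : Function.Injective M.val.toLinearMap := M.val.injective
  have hCB : C.map M.val.toLinearMap = B := by
    refine Submodule.map_comap_eq_self fun x hx => ⟨⟨x, hBM hx⟩, rfl⟩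
  have hfr (X : Submodule K M) : finrank K (X.map M.val.toLinearMap) = finrank K X :=
    (LinearEquiv.finrank_eq (X.equivMapOfInjective _ hinj)).symm
  have hpow (k : ℕ) :
      Submodule.span K ((B : Set L) ^ k) = (C ^ k).map M.val.toLinearMap := by
    rw [← Submodule.span_pow, Submodule.span_eq, Submodule.map_pow, hCB]
  have : FiniteDimensional K C := by
    have : FiniteDimensional K (C.map M.val.toLinearMap) := hCB ▸ inferInstance
    exact Module.Finite.equiv (C.equivMapOfInjective _ hinj).symm
  have hgen (H : IntermediateField K M) (hH : (C : Set M) ⊆ H) : H = ⊤ := by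
    have hle : M ≤ H.map M.val :=
      IntermediateField.adjoin_le_iff.2 fun x hx => ⟨⟨x, hBM hx⟩, hH hx, rfl⟩
    rw [eq_top_iff]
    intro x _
    obtain ⟨y, hy, hyx⟩ := hle x.2
    rwa [← M.val.injective hyx]
  have hBC : finrank K B = finrank K C := by rw [← hfr, hCB]
  rw [hpow, hpow, hpow, hBC, hfr, hfr]
  exact (pow_dichotomy_of_generating (B := C) hB hgen m).imp_left fun h => by rw [h]
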